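/- A Dyck path of length $2n$ is a lattice path from $(0,0)$ to $(2n,0)$ with steps $(1,1)$ (up-steps) and $(1,-1)$ (down-steps) that never goes below the $x$-axis; its up-step set is the set of all $i\in\{1,\dots,2n\}$ such that its $i$-th step is an up-step. The Catalan matroid $M_n$ is the matroid on $\{1,\dots,2n\}$ whose bases are the up-step sets of the Dyck paths of length $2n$. For $n\ge 2$, let $N_n$ be the matroid obtained from $M_n$ by deleting the elements $1$ and $2n$ (the isthmus and the loop of $M_n$). For a matroid $M$ on a finite set $E$ with rank function $r$, let $$T_M(x,y)=\sum_{A\subseteq E}(x-1)^{r(E)-r(A)}(y-1)^{|A|-r(A)}$$ be its Tutte polynomial. Theorem. For all $n\ge 2$, $$\max\{T_{N_n}(2,0),\,T_{N_n}(0,2)\}\ \ge\ T_{N_n}(1,1).$$ -/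

import Mathlib

open Classical in
/-- The Tutte polynomial of a matroid `M` on a finite ground set `E`, with `x = X 0`, `y = X 1`:
`∑_{A ⊆ E} (x - 1) ^ (r(E) - r(A)) * (y - 1) ^ (|A| - r(A))`. -/
noncomputable def tuttePolynomial {α : Type*} (M : Matroid α) [M.Finite] :
    MvPolynomial (Fin 2) ℤ :=
  ∑ A ∈ M.ground_finite.toFinset.powerset,
    (MvPolynomial.X 0 - 1) ^ (M.eRank.toNat - (M.eRk (A : Set α)).toNat) *
      (MvPolynomial.X 1 - 1) ^ (A.card - (M.eRk (A : Set α)).toNat)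

/-- The value `T_M(a, b)` of the Tutte polynomial at a pair of integers. -/
noncomputable def tutteEval {α : Type*} (M : Matroid α) [M.Finite] (a b : ℤ) : ℤ :=
  MvPolynomial.eval ![a, b] (tuttePolynomial M)

/-- The up-step set of a Dyck path: the positions `i`, counted from `1`, of its up-steps. -/
def upStepSet (p : DyckWord) : Set ℕ :=
  {i | 1 ≤ i ∧ p.toList[i - 1]? = some DyckStep.U}

/-- `B` is the up-step set of a Dyck path of length `2 * n`. -/
def IsUpStepSet (n : ℕ) (B : Set ℕ) : Prop :=
  ∃ p : DyckWord, p.toList.length = 2 * n ∧ upStepSet p = B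

theorem DyckStep.length_eq_count_add_count (l : List DyckStep) :
    l.length = l.count DyckStep.U + l.count DyckStep.D := by
  induction l with
  | nil => rfl
  | cons s l ih => cases s <;> simp <;> omega

open Classical in
theorem DyckStep.count_take_eq (l : List DyckStep) (k : ℕ) :
    (l.take k).count DyckStep.U = Nat.count (fun j => l[j]? = some DyckStep.U) k := by
  induction k with
  | zero => simp
  | succ k ih =>
    rw [List.take_add_one, List.count_append, ih, Nat.count_succ]
    congr 1
    rcases h : l[k]? with _ | s
    · simp
    · cases s <;> simp

open Classical in
/-- The number of elements of `B` in `{1, …, k}`. -/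
noncomputable def upCount (B : Set ℕ) (k : ℕ) : ℕ :=
  Nat.count (fun j => j + 1 ∈ B) k

open Classical in
theorem upCount_succ (B : Set ℕ) (k : ℕ) :
    upCount B (k + 1) = upCount B k + if k + 1 ∈ B then 1 else 0 :=
  Nat.count_succ _ _

theorem upCount_mono {A B : Set ℕ} {k : ℕ} (h : ∀ j < k, j + 1 ∈ A → j + 1 ∈ B) :
    upCount A k ≤ upCount B k :=
  by classical exact Nat.count_mono_left h

/-- Up-step sets of Dyck paths through their counting function. -/
theorem isUpStepSet_iff (n : ℕ) (B : Set ℕ) :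
    IsUpStepSet n B ↔ B ⊆ Set.Icc 1 (2 * n) ∧ upCount B (2 * n) = n ∧
      ∀ k ≤ 2 * n, k ≤ 2 * upCount B k := by
  classical
  constructor
  · rintro ⟨p, hp, rfl⟩
    have hc (k : ℕ) : upCount (upStepSet p) k =
        (p.toList.take k).count DyckStep.U := by
      rw [DyckStep.count_take_eq]
      simp [upCount, upStepSet]
    refine ⟨?_, ?_, ?_⟩
    · rintro i ⟨h1, h2⟩
      obtain ⟨h3, -⟩ := List.getElem?_eq_some_iff.1 h2
      exact ⟨h1, by omega⟩
    · rw [hc, ← hp, List.take_length]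
      have h1 := DyckStep.length_eq_count_add_count p.toList
      have h2 := p.count_U_eq_count_D
      omega
    · intro k hk
      rw [hc]
      have h1 := DyckStep.length_eq_count_add_count (p.toList.take k)
      have h2 := p.count_D_le_count_U k
      rw [List.length_take] at h1
      omega
  · rintro ⟨hB, hn, hk⟩
    let l : List DyckStep :=
      (List.range (2 * n)).map fun j => if j + 1 ∈ B then DyckStep.U else DyckStep.D
    have hl : l.length = 2 * n := by simp [l]
    have hget (j : ℕ) : l[j]? = some DyckStep.U ↔ j + 1 ∈ B := by
      by_cases hj : j < 2 * n
      · by_cases hjB : j + 1 ∈ B <;> simp [l, hj, hjB]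
      · have : j + 1 ∉ B := fun h => hj (by have := (hB h).2; omega)
        simp [l, hj, this]
    have hc (k : ℕ) : (l.take k).count DyckStep.U = upCount B k := by
      rw [DyckStep.count_take_eq, upCount]
      simp only [hget]
    have hcn : l.count DyckStep.U = n := by
      rw [← hn, ← hc, ← hl, List.take_length]
    have hlen := DyckStep.length_eq_count_add_count l
    refine ⟨⟨l, by omega, fun i => ?_⟩, hl, ?_⟩
    · rcases le_total i (2 * n) with hi | hi
      · have h1 := DyckStep.length_eq_count_add_count (l.take i)
        have h2 := hk i hi
        rw [hc] at h1 ⊢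
        rw [List.length_take] at h1
        omega
      · rw [List.take_of_length_le (by omega)]
        omega
    · ext i
      rcases i with _ | i
      · have : 0 ∉ B := fun h => by simpa using (hB h).1
        simp [upStepSet, this]
      · simp [upStepSet, hget]

theorem count_exchange {X : Set ℕ} {a b : ℕ} (ha : a ∈ X) (hb : b ∉ X) (ha1 : 1 ≤ a)
    (hb1 : 1 ≤ b) (k : ℕ) :
    upCount (insert b (X \ {a})) k + (if a ≤ k then 1 else 0) =
      upCount X k + (if b ≤ k then 1 else 0) := by
  have hab : a ≠ b := fun h => hb (h ▸ ha)
  induction k with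
  | zero => simp [upCount, show a ≠ 0 by omega, show b ≠ 0 by omega]
  | succ k ih =>
    rw [upCount_succ, upCount_succ]
    by_cases h1 : k + 1 = a
    · subst h1
      have : k + 1 ∉ insert b (X \ {k + 1}) := by simp [hab]
      simp only [this, ha, if_true, if_false]
      split_ifs at * <;> omega
    · by_cases h2 : k + 1 = b
      · subst h2
        have : k + 1 ∈ insert (k + 1) (X \ {a}) := by simp
        simp only [this, hb, if_true, if_false]
        split_ifs at * <;> omega
      · have : k + 1 ∈ insert b (X \ {a}) ↔ k + 1 ∈ X := by simp [h1, h2]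
        by_cases h3 : k + 1 ∈ X
        · rw [if_pos h3, if_pos (this.2 h3)]
          split_ifs at * <;> omega
        · rw [if_neg h3, if_neg (fun h => h3 (this.1 h))]
          split_ifs at * <;> omega

theorem exists_isUpStepSet (n : ℕ) : ∃ B, IsUpStepSet n B := by
  classical
  have hc (k : ℕ) (hk : k ≤ n) :
      upCount (Set.Icc 1 n) k = k := by
    induction k with
    | zero => simp [upCount]
    | succ k ih =>
      have : k + 1 ∈ Set.Icc 1 n := ⟨by omega, hk⟩
      rw [upCount_succ, ih (by omega), if_pos this]
  have hc' (k : ℕ) : upCount (Set.Icc 1 n) (n + k) = n := by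
    induction k with
    | zero => exact hc n le_rfl
    | succ k ih =>
      have : n + k + 1 ∉ Set.Icc 1 n := fun h => by have := h.2; omega
      rw [← add_assoc, upCount_succ, ih, if_neg this, add_zero]
  refine ⟨Set.Icc 1 n, (isUpStepSet_iff _ _).2 ⟨?_, ?_, ?_⟩⟩
  · exact Set.Icc_subset_Icc le_rfl (by omega)
  · rw [two_mul]
    exact hc' n
  · intro k hk
    rcases le_total k n with h | h
    · rw [hc k h]
      omega
    · obtain ⟨d, rfl⟩ := Nat.exists_eq_add_of_le h
      rw [hc' d]
      omega

theorem isUpStepSet_exchange (n : ℕ) : Matroid.ExchangeProperty (IsUpStepSet n) := by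
  classical
  intro X Y hX hY a ha
  obtain ⟨hXE, hXn, hXk⟩ := (isUpStepSet_iff _ _).1 hX
  obtain ⟨hYE, hYn, hYk⟩ := (isUpStepSet_iff _ _).1 hY
  have hne : ∃ b, b ∈ Y \ X := by
    by_contra! hcon
    have hYX : Y ⊆ X := fun y hy => by_contra fun h => hcon y ⟨hy, h⟩
    have h1 : a ≤ 2 * n := (hXE ha.1).2
    have h0 : 1 ≤ a := (hXE ha.1).1
    have hlt := count_exchange (X := X) (a := a) (b := 2 * n + 1) ha.1
      (fun h => by have := (hXE h).2; omega) h0 (by omega) (2 * n)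
    have hle : upCount Y (2 * n) ≤
        upCount (insert (2 * n + 1) (X \ {a})) (2 * n) :=
      upCount_mono fun k _ hkY =>
        Or.inr ⟨hYX hkY, fun h => ha.2 (by rw [← Set.mem_singleton_iff.1 h]; exact hkY)⟩
    rw [if_pos h1, if_neg (by omega)] at hlt
    omega
  let b := Nat.find hne
  have hb : b ∈ Y \ X := Nat.find_spec hne
  have hmin (k : ℕ) (hk : k < b) (hkY : k ∈ Y) : k ∈ X :=
    by_contra fun h => Nat.find_min hne hk ⟨hkY, h⟩
  have hcount := count_exchange ha.1 hb.2 (hXE ha.1).1 (hYE hb.1).1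
  refine ⟨b, hb, (isUpStepSet_iff _ _).2 ⟨?_, ?_, fun k hk => ?_⟩⟩
  · exact Set.insert_subset (hYE hb.1) (Set.sdiff_subset.trans hXE)
  · have := hcount (2 * n)
    rw [if_pos (hXE ha.1).2, if_pos (hYE hb.1).2] at this
    omega
  · by_cases hkb : b ≤ k
    · have h1 := hcount k
      have h2 := hXk k hk
      rw [if_pos hkb] at h1
      split_ifs at h1 <;> omega
    · refine (hYk k hk).trans (Nat.mul_le_mul_left 2 (upCount_mono fun j hj hjY => ?_))
      exact Or.inr ⟨hmin _ (by omega) hjY,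
        fun h => ha.2 (by rw [← Set.mem_singleton_iff.1 h]; exact hjY)⟩

/-- The Catalan matroid `M_n` on `{1, …, 2n}`: its bases are the up-step sets of the Dyck paths of
length `2n`. -/
def catalanMatroid (n : ℕ) : Matroid ℕ :=
  Matroid.ofIsBaseOfFinite (E := Set.Icc 1 (2 * n)) (Set.finite_Icc 1 (2 * n)) (IsUpStepSet n)
    (exists_isUpStepSet n) (isUpStepSet_exchange n)
    fun B hB => ((isUpStepSet_iff n B).1 hB).1

instance catalanMatroid_finite (n : ℕ) : (catalanMatroid n).Finite :=
  ⟨Set.finite_Icc 1 (2 * n)⟩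

/-- The matroid `N_n`: the Catalan matroid `M_n` with the elements `1` (its isthmus) and `2n`
(its loop) deleted. -/
def reducedCatalanMatroid (n : ℕ) : Matroid ℕ :=
  (catalanMatroid n).delete {1, 2 * n}

instance reducedCatalanMatroid_finite (n : ℕ) : (reducedCatalanMatroid n).Finite :=
  Matroid.delete_finite

/-! The value at `(0, 2)` alone dominates. There `y - 1 = 1`, so it is the sum of the signs `(-1) ^
(r(E) - r(C))` over all subsets `C` of `{2, …, 2n-1}`. Call `C` good if `HasManyUpSteps n C`. For a
bad `C`, let `2k` be its first failing prefix length. Toggling `2k+1` leaves that prefix alone, so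
it is an involution on bad sets, and it changes the rank by exactly one
(`eRk_insert_of_first_failure`). The bad sets cancel; good sets have full rank, so the value counts
them (`tutteEval_zero_two`).

The value at `(1, 1)` counts bases, and a base `A` makes `{1} ∪ A` the up-step set of a Dyck path.
Moving these up-steps one place to the right injects bases into good sets (`tutteEval_one_one_le`).
-/

/-! ### Prefix counts -/

theorem upCount_zero (S : Set ℕ) : upCount S 0 = 0 := by
  simp [upCount]

theorem upCount_mono_right (S : Set ℕ) {j k : ℕ} (h : j ≤ k) : upCount S j ≤ upCount S k := by
  classical exact Nat.count_monotone _ h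

theorem upCount_congr {A B : Set ℕ} {k : ℕ} (h : ∀ j < k, j + 1 ∈ A ↔ j + 1 ∈ B) :
    upCount A k = upCount B k :=
  le_antisymm (upCount_mono fun j hj => (h j hj).1) (upCount_mono fun j hj => (h j hj).2)

theorem upCount_insert {S : Set ℕ} {b : ℕ} (hb : b ∉ S) (hb1 : 1 ≤ b) (k : ℕ) :
    upCount (insert b S) k = upCount S k + if b ≤ k then 1 else 0 := by
  classical
  induction k with
  | zero => simp [upCount, show b ≠ 0 by omega]
  | succ k ih =>
    rw [upCount_succ, upCount_succ, ih]
    by_cases h : k + 1 = b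
    · subst h
      simp [hb]
    · simp only [Set.mem_insert_iff, h, false_or]
      split_ifs <;> omega

theorem encard_inter_Icc (S : Set ℕ) (k : ℕ) : (S ∩ Set.Icc 1 k).encard = upCount S k := by
  classical
  induction k with
  | zero => simp [upCount]
  | succ k ih =>
    have hI : Set.Icc 1 (k + 1) = insert (k + 1) (Set.Icc 1 k) := by
      ext i
      simp only [Set.mem_Icc, Set.mem_insert_iff]
      omega
    rw [upCount_succ, hI]
    split_ifs with h
    · rw [Set.inter_insert_of_mem h, Set.encard_insert_of_notMem (by simp), ih]
      push_cast
      rfl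
    · rw [Set.inter_insert_of_notMem h, ih]
      simp

/-! ### Spanning sets of the Catalan matroid -/

theorem catalanMatroid_ground (n : ℕ) : (catalanMatroid n).E = Set.Icc 1 (2 * n) := rfl

theorem catalanMatroid_isBase_iff (n : ℕ) (B : Set ℕ) :
    (catalanMatroid n).IsBase B ↔ IsUpStepSet n B := by
  simp [catalanMatroid]

theorem IsUpStepSet.encard_eq {n : ℕ} {B : Set ℕ} (hB : IsUpStepSet n B) : B.encard = n := by
  obtain ⟨h1, h2, -⟩ := (isUpStepSet_iff n B).1 hB
  rw [← Set.inter_eq_left.2 h1, encard_inter_Icc, h2]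

theorem catalanMatroid_eRank (n : ℕ) : (catalanMatroid n).eRank = n := by
  obtain ⟨B, hB⟩ := exists_isUpStepSet n
  rw [← ((catalanMatroid_isBase_iff n B).2 hB).encard_eq_eRank, hB.encard_eq]

/-- Under the prefix condition, the first `n` elements of `S` already form a base: truncating the
counts at `n` does not break the bound, since `k ≤ 2 * n`. -/
theorem catalanMatroid_spanning_iff {n : ℕ} {S : Set ℕ} (hS : S ⊆ Set.Icc 1 (2 * n)) :
    (catalanMatroid n).Spanning S ↔ ∀ k ≤ 2 * n, k ≤ 2 * upCount S k := by
  classical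
  rw [Matroid.spanning_iff_exists_isBase_subset hS]
  constructor
  · rintro ⟨B, hB, hBS⟩ k hk
    have h := ((isUpStepSet_iff n B).1 ((catalanMatroid_isBase_iff n B).1 hB)).2.2 k hk
    have h2 : upCount B k ≤ upCount S k := upCount_mono fun j _ hj => hBS hj
    omega
  · intro h
    have hc (k : ℕ) : upCount {i ∈ S | upCount S i ≤ n} k = min (upCount S k) n := by
      induction k with
      | zero => rw [upCount_zero, upCount_zero, Nat.zero_min]
      | succ k ih =>
        rw [upCount_succ, ih]
        have h1 := upCount_succ S k
        by_cases hk : k + 1 ∈ S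
        · simp only [Set.mem_ofPred_eq, hk, true_and, if_true] at h1 ⊢
          split_ifs <;> omega
        · simp only [Set.mem_ofPred_eq, hk, false_and, if_false] at h1 ⊢
          omega
    refine ⟨{i ∈ S | upCount S i ≤ n}, ?_, Set.sep_subset _ _⟩
    rw [catalanMatroid_isBase_iff, isUpStepSet_iff]
    refine ⟨(Set.sep_subset _ _).trans hS, ?_, fun k hk => ?_⟩
    · rw [hc]
      have := h (2 * n) le_rfl
      omega
    · rw [hc]
      have := h k hk
      omega

/-! ### Rank in the reduced matroid -/

/-- The prefixes of even length `2 * k < 2 * n` contain at least `k` elements of `C`. -/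
def HasManyUpSteps (n : ℕ) (C : Set ℕ) : Prop :=
  ∀ k < n, k ≤ upCount C (2 * k)

theorem reducedCatalanMatroid_ground {n : ℕ} (hn : 1 ≤ n) :
    (reducedCatalanMatroid n).E = Set.Icc 2 (2 * n - 1) := by
  ext i
  simp only [reducedCatalanMatroid, Matroid.delete_ground, catalanMatroid_ground, Set.mem_sdiff,
    Set.mem_Icc, Set.mem_insert_iff, Set.mem_singleton_iff]
  omega

theorem reducedCatalanMatroid_eRk {n : ℕ} {C : Set ℕ} (hn : 1 ≤ n)
    (hC : C ⊆ Set.Icc 2 (2 * n - 1)) :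
    (reducedCatalanMatroid n).eRk C = (catalanMatroid n).eRk C := by
  rw [reducedCatalanMatroid, ← Matroid.restrict_compl, Matroid.restrict_eRk_eq]
  exact hC.trans (reducedCatalanMatroid_ground hn).superset

theorem reducedCatalanMatroid_eRk_ne_top {n : ℕ} (C : Set ℕ) :
    (reducedCatalanMatroid n).eRk C ≠ ⊤ :=
  (Matroid.eRk_lt_top_iff.2 (Matroid.isRkFinite_set _ C)).ne

theorem Icc_two_subset {n : ℕ} : Set.Icc 2 (2 * n - 1) ⊆ Set.Icc 1 (2 * n) :=
  Set.Icc_subset_Icc (by omega) (by omega)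

/-- Without the element `1` the prefix of length one is empty, so the remaining elements do not span
`M_n`. -/
theorem reducedCatalanMatroid_eRank_lt {n : ℕ} (hn : 1 ≤ n) :
    (reducedCatalanMatroid n).eRank < n := by
  rw [← Matroid.eRk_ground, reducedCatalanMatroid_ground hn, reducedCatalanMatroid_eRk hn subset_rfl]
  by_contra! h
  rw [← catalanMatroid_eRank, ← Matroid.spanning_iff_eRk_le Icc_two_subset,
    catalanMatroid_spanning_iff Icc_two_subset] at h
  have := h 1 (by omega)
  simp [upCount, Nat.count_succ] at this

theorem HasManyUpSteps.spanning_insert {n : ℕ} {C : Set ℕ} (h : HasManyUpSteps n C)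
    (hC : C ⊆ Set.Icc 2 (2 * n - 1)) (hn : 1 ≤ n) : (catalanMatroid n).Spanning (insert 1 C) := by
  have h1 : 1 ∉ C := fun h => by simpa using (hC h).1
  rw [catalanMatroid_spanning_iff
    (Set.insert_subset ⟨le_rfl, by omega⟩ (hC.trans Icc_two_subset))]
  intro k hk
  rw [upCount_insert h1 le_rfl]
  rcases Nat.eq_zero_or_pos k with rfl | hk0
  · simp
  -- The longest even prefix of length at most `k - 1`: its index stays below `n`, and the extra
  -- element `1` makes up for the rounding.
  have h2 := h ((k - 1) / 2) (by omega)
  have h3 := upCount_mono_right C (show 2 * ((k - 1) / 2) ≤ k by omega)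
  rw [if_pos (show 1 ≤ k from hk0)]
  omega

theorem HasManyUpSteps.eRk_eq {n : ℕ} {C : Set ℕ} (h : HasManyUpSteps n C)
    (hC : C ⊆ Set.Icc 2 (2 * n - 1)) (hn : 1 ≤ n) :
    (reducedCatalanMatroid n).eRk C = (reducedCatalanMatroid n).eRank := by
  refine le_antisymm (Matroid.eRk_le_eRank _ _) ?_
  have h1 := (h.spanning_insert hC hn).eRk_eq
  have h2 := (catalanMatroid n).eRk_insert_le_add_one 1 C
  rw [h1, catalanMatroid_eRank, ← reducedCatalanMatroid_eRk hn hC] at h2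
  exact Order.lt_add_one_iff_of_not_isMax (by simp [reducedCatalanMatroid_eRk_ne_top C]) |>.1
    ((reducedCatalanMatroid_eRank_lt hn).trans_le h2)

/-- A superset `K` of `C` witnesses that `2k+1` is outside the closure of `C`: add `1` and
everything after `2k+1`. Then `K` has only `k` elements up to `2k+1`, so it does not span `M_n`,
whereas `K` with `2k+1` does. -/
theorem eRk_insert_of_first_failure {n k : ℕ} {C : Set ℕ} (hC : C ⊆ Set.Icc 2 (2 * n - 1))
    (hk : k < n) (hlt : upCount C (2 * k) < k) (hle : ∀ j < k, j ≤ upCount C (2 * j))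
    (he : 2 * k + 1 ∉ C) :
    (reducedCatalanMatroid n).eRk (insert (2 * k + 1) C) =
      (reducedCatalanMatroid n).eRk C + 1 := by
  have h1C : 1 ∉ C := fun h => by simpa using (hC h).1
  have heE : 2 * k + 1 ∈ Set.Icc 2 (2 * n - 1) := ⟨by omega, by omega⟩
  rw [reducedCatalanMatroid_eRk (by omega) hC,
    reducedCatalanMatroid_eRk (by omega) (Set.insert_subset heE hC)]
  refine Matroid.eRk_insert_eq_add_one ⟨Icc_two_subset heE, fun hcl => ?_⟩
  let K : Set ℕ := {i | i ∈ Set.Icc 1 (2 * n) ∧ (i = 1 ∨ (i ≤ 2 * k ∧ i ∈ C) ∨ 2 * k + 2 ≤ i)}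
  have hKE : K ⊆ Set.Icc 1 (2 * n) := fun i hi => hi.1
  have hCK : C ⊆ K := fun i hi => by
    refine ⟨Icc_two_subset (hC hi), ?_⟩
    by_cases h : i = 2 * k + 1
    · exact absurd (h ▸ hi) he
    · by_cases h2 : i ≤ 2 * k
      · exact Or.inr (Or.inl ⟨h2, hi⟩)
      · exact Or.inr (Or.inr (by omega))
  have heK : 2 * k + 1 ∉ K := by
    rintro ⟨-, h | h | h⟩ <;> omega
  have hK1 (j : ℕ) (hj : j ≤ 2 * k) : upCount K j = upCount (insert 1 C) j := by
    refine upCount_congr fun i hi => ?_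
    simp only [K, Set.mem_ofPred_eq, Set.mem_Icc, Set.mem_insert_iff]
    constructor
    · rintro ⟨-, h | h | h⟩
      · exact Or.inl h
      · exact Or.inr h.2
      · omega
    · rintro (h | h)
      · exact ⟨⟨by omega, by omega⟩, Or.inl h⟩
      · exact ⟨⟨by omega, by omega⟩, Or.inr (Or.inl ⟨by omega, h⟩)⟩
  have hK2 (j : ℕ) (hj : j ≤ 2 * k) (hj1 : 1 ≤ j) : upCount K j = upCount C j + 1 := by
    rw [hK1 j hj, upCount_insert h1C le_rfl, if_pos hj1]
  -- Minimality of `k` makes the deficit exactly one.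
  have hk1 : k - 1 ≤ upCount C (2 * k) :=
    (hle (k - 1) (by omega)).trans (upCount_mono_right C (by omega))
  have hK3 : upCount K (2 * k) = k := by
    rw [hK2 _ le_rfl (by omega)]
    omega
  have hK4 (d : ℕ) (hd : 2 * k + 1 + d ≤ 2 * n) : upCount K (2 * k + 1 + d) = k + d := by
    induction d with
    | zero => rw [add_zero, upCount_succ, hK3, if_neg heK]
    | succ d ih =>
      have : 2 * k + 1 + d + 1 ∈ K := ⟨⟨by omega, by omega⟩, Or.inr (Or.inr (by omega))⟩
      rw [← add_assoc, upCount_succ, ih (by omega), if_pos this, add_assoc]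
  have hspan : (catalanMatroid n).Spanning (insert (2 * k + 1) K) := by
    rw [catalanMatroid_spanning_iff (Set.insert_subset (Icc_two_subset heE) hKE)]
    intro j hj
    rw [upCount_insert heK (by omega)]
    by_cases hjk : j ≤ 2 * k
    · rw [if_neg (by omega), add_zero]
      rcases Nat.eq_zero_or_pos j with rfl | hj0
      · simp
      rw [hK2 j hjk hj0]
      have h2 := hle ((j - 1) / 2) (by omega)
      have h3 := upCount_mono_right C (show 2 * ((j - 1) / 2) ≤ j by omega)
      omega
    · obtain ⟨d, rfl⟩ := Nat.exists_eq_add_of_le (show 2 * k + 1 ≤ j by omega)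
      rw [hK4 d hj, if_pos (by omega)]
      omega
  have hKspan : (catalanMatroid n).Spanning K := by
    rw [Matroid.spanning_iff_closure_eq hKE, ← hspan.closure_eq]
    exact (Matroid.closure_insert_eq_of_mem_closure
      ((catalanMatroid n).closure_subset_closure hCK hcl)).symm
  have := (catalanMatroid_spanning_iff hKE).1 hKspan (2 * k + 1) (by omega)
  rw [hK4 0 (by omega)] at this
  omega

/-! ### The value at `(0, 2)`: a sign-reversing involution -/

theorem tutteEval_eq {n : ℕ} (hn : 1 ≤ n) (a b : ℤ) :
    tutteEval (reducedCatalanMatroid n) a b =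
      ∑ A ∈ (Finset.Icc 2 (2 * n - 1)).powerset,
        (a - 1) ^ ((reducedCatalanMatroid n).eRank.toNat -
            ((reducedCatalanMatroid n).eRk (A : Set ℕ)).toNat) *
          (b - 1) ^ (A.card - ((reducedCatalanMatroid n).eRk (A : Set ℕ)).toNat) := by
  have hE : (reducedCatalanMatroid n).ground_finite.toFinset = Finset.Icc 2 (2 * n - 1) := by
    ext i
    simp [reducedCatalanMatroid_ground hn]
  simp [tutteEval, tuttePolynomial, hE]

/-- The least `k < n` for which the prefix of length `2 * k` has fewer than `k` elements of `C`. -/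
noncomputable def firstFailure (n : ℕ) (C : Set ℕ) : ℕ :=
  sInf {k | k < n ∧ upCount C (2 * k) < k}

theorem firstFailure_spec {n : ℕ} {C : Set ℕ} (h : ¬ HasManyUpSteps n C) :
    (firstFailure n C < n ∧ upCount C (2 * firstFailure n C) < firstFailure n C) ∧
      ∀ j < firstFailure n C, j ≤ upCount C (2 * j) := by
  have hne : {k | k < n ∧ upCount C (2 * k) < k}.Nonempty := by
    simp only [HasManyUpSteps, not_forall, not_le] at h
    obtain ⟨k, h1, h2⟩ := h
    exact ⟨k, h1, h2⟩
  have hmem := Nat.sInf_mem hne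
  refine ⟨hmem, fun j hj => ?_⟩
  by_contra! hlt
  exact Nat.notMem_of_lt_sInf hj ⟨hj.trans hmem.1, hlt⟩

theorem firstFailure_eq {n k : ℕ} {C : Set ℕ} (hk : k < n) (hlt : upCount C (2 * k) < k)
    (hle : ∀ j < k, j ≤ upCount C (2 * j)) : firstFailure n C = k := by
  have h : ¬ HasManyUpSteps n C := fun h => (h k hk).not_gt hlt
  obtain ⟨⟨-, h2⟩, h3⟩ := firstFailure_spec h
  rcases lt_trichotomy (firstFailure n C) k with h4 | h4 | h4
  · exact absurd (hle _ h4) h2.not_ge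
  · exact h4
  · exact absurd (h3 _ h4) hlt.not_ge

/-- Toggle the element just after the first failing prefix. -/
noncomputable def toggle (n : ℕ) (C : Finset ℕ) : Finset ℕ :=
  symmDiff C {2 * firstFailure n C + 1}

theorem upCount_toggle (n : ℕ) (C : Finset ℕ) {j : ℕ} (hj : j ≤ 2 * firstFailure n C) :
    upCount (toggle n C : Finset ℕ) j = upCount C j := by
  refine upCount_congr fun i hi => ?_
  have : i ≠ 2 * firstFailure n C := by omega
  simp [toggle, Set.mem_symmDiff, this]

theorem firstFailure_toggle {n : ℕ} {C : Finset ℕ} (h : ¬ HasManyUpSteps n C) :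
    firstFailure n (toggle n C : Finset ℕ) = firstFailure n C := by
  obtain ⟨⟨h1, h2⟩, h3⟩ := firstFailure_spec h
  refine firstFailure_eq h1 ?_ fun j hj => ?_
  · rwa [upCount_toggle n C le_rfl]
  · rw [upCount_toggle n C (by omega)]
    exact h3 j hj

theorem not_hasManyUpSteps_toggle {n : ℕ} {C : Finset ℕ} (h : ¬ HasManyUpSteps n C) :
    ¬ HasManyUpSteps n (toggle n C : Finset ℕ) := by
  obtain ⟨⟨h1, h2⟩, -⟩ := firstFailure_spec h
  intro h4
  have := h4 _ h1
  rw [upCount_toggle n C le_rfl] at this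
  omega

theorem toggle_toggle {n : ℕ} {C : Finset ℕ} (h : ¬ HasManyUpSteps n C) :
    toggle n (toggle n C) = C := by
  rw [toggle, firstFailure_toggle h, toggle, symmDiff_symmDiff_cancel_right]

theorem toggle_subset {n : ℕ} {C : Finset ℕ} (hC : C ⊆ Finset.Icc 2 (2 * n - 1))
    (h : ¬ HasManyUpSteps n C) : toggle n C ⊆ Finset.Icc 2 (2 * n - 1) := by
  obtain ⟨⟨h1, h2⟩, -⟩ := firstFailure_spec h
  intro i hi
  rcases Finset.mem_symmDiff.1 hi with hi | hi
  · exact hC hi.1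
  · rw [Finset.mem_singleton.1 hi.1, Finset.mem_Icc]
    omega

/-- The corank sign `(-1) ^ (r(E) - r(C))` in the reduced Catalan matroid. -/
noncomputable def corankSign (n : ℕ) (C : Finset ℕ) : ℤ :=
  (-1) ^ ((reducedCatalanMatroid n).eRank.toNat -
    ((reducedCatalanMatroid n).eRk (C : Set ℕ)).toNat)

theorem corankSign_add_toggle_of_notMem {n : ℕ} {C : Finset ℕ}
    (hC : C ⊆ Finset.Icc 2 (2 * n - 1)) (h : ¬ HasManyUpSteps n C)
    (he : 2 * firstFailure n C + 1 ∉ C) : corankSign n C + corankSign n (toggle n C) = 0 := by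
  obtain ⟨⟨h1, h2⟩, h3⟩ := firstFailure_spec h
  have hC' : (C : Set ℕ) ⊆ Set.Icc 2 (2 * n - 1) := by
    rwa [← Finset.coe_Icc, Finset.coe_subset]
  have ht : ((toggle n C : Finset ℕ) : Set ℕ) = insert (2 * firstFailure n C + 1) (C : Set ℕ) := by
    ext i
    by_cases hi : i = 2 * firstFailure n C + 1
    · subst hi
      simp [toggle, Set.mem_symmDiff, he]
    · simp [toggle, Set.mem_symmDiff, hi]
  have hr := eRk_insert_of_first_failure hC' h1 h2 h3 (by simpa using he)
  have hle := (reducedCatalanMatroid n).eRk_le_eRank (insert (2 * firstFailure n C + 1) (C : Set ℕ))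
  have htop : (reducedCatalanMatroid n).eRank ≠ ⊤ := by
    rw [← Matroid.eRk_ground]
    exact reducedCatalanMatroid_eRk_ne_top _
  have hle' := ENat.toNat_le_toNat hle htop
  rw [hr, ENat.toNat_add (reducedCatalanMatroid_eRk_ne_top _) (by simp), ENat.toNat_one] at hle'
  rw [corankSign, corankSign, ht, hr, ENat.toNat_add (reducedCatalanMatroid_eRk_ne_top _) (by simp),
    ENat.toNat_one]
  -- With the rank written as `r(C) + 1 + d`, the truncated exponents are `d + 1` and `d`.
  obtain ⟨d, hd⟩ := Nat.exists_eq_add_of_le hle'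
  rw [hd, Nat.add_sub_cancel_left, add_assoc, Nat.add_sub_cancel_left, pow_add]
  ring

theorem corankSign_add_toggle {n : ℕ} {C : Finset ℕ}
    (hC : C ⊆ Finset.Icc 2 (2 * n - 1)) (h : ¬ HasManyUpSteps n C) :
    corankSign n C + corankSign n (toggle n C) = 0 := by
  by_cases he : 2 * firstFailure n C + 1 ∈ C
  · have := corankSign_add_toggle_of_notMem (toggle_subset hC h) (not_hasManyUpSteps_toggle h)
      (by rw [firstFailure_toggle h]; simp [toggle, Finset.mem_symmDiff, he])
    rwa [toggle_toggle h, add_comm] at this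
  · exact corankSign_add_toggle_of_notMem hC h he

open Classical in
theorem tutteEval_zero_two {n : ℕ} (hn : 1 ≤ n) :
    tutteEval (reducedCatalanMatroid n) 0 2 =
      ((Finset.Icc 2 (2 * n - 1)).powerset.filter fun C : Finset ℕ => HasManyUpSteps n C).card := by
  have h0 : tutteEval (reducedCatalanMatroid n) 0 2 =
      ∑ C ∈ (Finset.Icc 2 (2 * n - 1)).powerset, corankSign n C := by
    rw [tutteEval_eq hn]
    refine Finset.sum_congr rfl fun C _ => ?_
    norm_num [corankSign]
  rw [h0, ← Finset.sum_filter_add_sum_filter_not _ (fun C : Finset ℕ => HasManyUpSteps n C)]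
  have hgood : ∀ C ∈ ((Finset.Icc 2 (2 * n - 1)).powerset.filter fun C : Finset ℕ => HasManyUpSteps n C),
      corankSign n C = 1 := by
    intro C hC
    rw [Finset.mem_filter, Finset.mem_powerset] at hC
    rw [corankSign, hC.2.eRk_eq (by rw [← Finset.coe_Icc, Finset.coe_subset]; exact hC.1) hn, Nat.sub_self, pow_zero]
  rw [Finset.sum_congr rfl hgood, Finset.sum_const, nsmul_one, add_eq_left]
  refine Finset.sum_involution (fun C _ => toggle n C) ?_ ?_ ?_ ?_
  · intro C hC
    rw [Finset.mem_filter, Finset.mem_powerset] at hC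
    exact corankSign_add_toggle hC.1 hC.2
  · intro C _ _ h
    have := symmDiff_eq_left.1 h
    simp at this
  · intro C hC
    rw [Finset.mem_filter, Finset.mem_powerset] at hC ⊢
    exact ⟨toggle_subset hC.1 hC.2, not_hasManyUpSteps_toggle hC.2⟩
  · intro C hC
    rw [Finset.mem_filter] at hC
    exact toggle_toggle hC.2

/-! ### The value at `(1, 1)`: bases and shifted paths -/

/-- The hypotheses say that both Tutte exponents vanish, i.e. `A` is a base. It extends to a base of
`M_n`, which must contain `1`; as `N_n` has rank at least `n - 1`, nothing else is added. -/
theorem isUpStepSet_insert_one {n : ℕ} (hn : 1 ≤ n) {A : Finset ℕ}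
    (hA : A ⊆ Finset.Icc 2 (2 * n - 1))
    (hr : (reducedCatalanMatroid n).eRank.toNat ≤
      ((reducedCatalanMatroid n).eRk (A : Set ℕ)).toNat)
    (hc : A.card ≤ ((reducedCatalanMatroid n).eRk (A : Set ℕ)).toNat) :
    IsUpStepSet n (insert 1 (A : Set ℕ)) ∧ A.card + 1 = n := by
  have hA' : (A : Set ℕ) ⊆ Set.Icc 2 (2 * n - 1) := by
    rwa [← Finset.coe_Icc, Finset.coe_subset]
  have h1A : 1 ∉ A := fun h => by simpa using (Finset.mem_Icc.1 (hA h)).1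
  have hrk : (reducedCatalanMatroid n).eRk (A : Set ℕ) = A.card := by
    have hle := (reducedCatalanMatroid n).eRk_le_encard (A : Set ℕ)
    rw [Set.encard_coe_eq_coe_finsetCard] at hle
    refine le_antisymm hle ?_
    rw [← ENat.natCast_toNat (reducedCatalanMatroid_eRk_ne_top (A : Set ℕ))]
    exact_mod_cast hc
  have hI : (catalanMatroid n).Indep (A : Set ℕ) := by
    rw [Matroid.indep_iff_eRk_eq_encard_of_finite A.finite_toSet,
      ← reducedCatalanMatroid_eRk hn hA', hrk, Set.encard_coe_eq_coe_finsetCard]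
  have hrank : n ≤ (reducedCatalanMatroid n).eRank.toNat + 1 := by
    have hIcc : HasManyUpSteps n (Set.Icc 2 (2 * n - 1)) := by
      have hc (j : ℕ) (hj : j + 1 ≤ 2 * n - 1) : upCount (Set.Icc 2 (2 * n - 1)) (j + 1) = j := by
        induction j with
        | zero => simp [upCount, Nat.count_succ]
        | succ j ih =>
          have : j + 1 + 1 ∈ Set.Icc 2 (2 * n - 1) := ⟨by omega, hj⟩
          rw [upCount_succ, ih (by omega), if_pos this]
      intro k hk
      rcases Nat.eq_zero_or_pos k with rfl | hk0
      · simp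
      rw [show 2 * k = 2 * k - 1 + 1 by omega, hc _ (by omega)]
      omega
    have h1 := (hIcc.spanning_insert subset_rfl hn).eRk_eq
    have h2 := (catalanMatroid n).eRk_insert_le_add_one 1 (Set.Icc 2 (2 * n - 1))
    rw [h1, catalanMatroid_eRank, ← reducedCatalanMatroid_eRk hn subset_rfl,
      hIcc.eRk_eq subset_rfl hn] at h2
    have htop : (reducedCatalanMatroid n).eRank ≠ ⊤ := by
      rw [← Matroid.eRk_ground]
      exact reducedCatalanMatroid_eRk_ne_top _
    rw [← ENat.natCast_toNat htop] at h2
    exact_mod_cast h2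
  obtain ⟨B, hB, hAB⟩ := hI.exists_isBase_superset
  rw [catalanMatroid_isBase_iff] at hB
  have h1B : 1 ∈ B := by
    have := ((isUpStepSet_iff n B).1 hB).2.2 1 (by omega)
    by_contra h
    simp [upCount, Nat.count_succ, h] at this
  have hsub : insert 1 (A : Set ℕ) ⊆ B := Set.insert_subset h1B hAB
  have hcard : (insert 1 (A : Set ℕ)).encard = (A.card + 1 : ℕ) := by
    rw [Set.encard_insert_of_notMem (by simpa using h1A), Set.encard_coe_eq_coe_finsetCard]
    rfl
  have hfin : B.Finite := (Set.finite_Icc 1 (2 * n)).subset ((isUpStepSet_iff n B).1 hB).1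
  have heq : insert 1 (A : Set ℕ) = B := by
    refine hfin.eq_of_subset_of_encard_le' hsub ?_
    rw [hB.encard_eq, hcard]
    have : n ≤ A.card + 1 := by
      rw [hrk, ENat.toNat_natCast] at hr
      omega
    exact_mod_cast this
  refine ⟨heq ▸ hB, ?_⟩
  rw [heq, hB.encard_eq] at hcard
  exact_mod_cast hcard.symm

/-- The up-steps of the path with up-step set `{1} ∪ A`, moved one step to the right, without those
that leave `{2, …, 2n - 1}`. -/
def shiftUpSteps (n : ℕ) (A : Finset ℕ) : Finset ℕ :=
  {i ∈ Finset.Icc 2 (2 * n - 1) | i = 2 ∨ i - 1 ∈ A}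

theorem upCount_shiftUpSteps (n : ℕ) (A : Finset ℕ) {j : ℕ} (hj : j + 1 ≤ 2 * n - 1) :
    upCount (shiftUpSteps n A : Finset ℕ) (j + 1) = upCount (insert 1 (A : Set ℕ)) j := by
  induction j with
  | zero => simp [upCount, Nat.count_succ, shiftUpSteps]
  | succ j ih =>
    rw [upCount_succ, ih (by omega), upCount_succ]
    congr 2
    have : j + 2 ≤ 2 * n - 1 := hj
    simp [shiftUpSteps, this, add_assoc]

theorem hasManyUpSteps_shiftUpSteps {n : ℕ} {A : Finset ℕ}
    (h : IsUpStepSet n (insert 1 (A : Set ℕ))) :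
    HasManyUpSteps n (shiftUpSteps n A : Finset ℕ) := by
  intro k hk
  rcases Nat.eq_zero_or_pos k with rfl | hk0
  · simp
  -- By parity, a Dyck prefix of odd length `2k-1` has at least `k` up-steps.
  have h1 := ((isUpStepSet_iff _ _).1 h).2.2 (2 * k - 1) (by omega)
  rw [show 2 * k = 2 * k - 1 + 1 by omega, upCount_shiftUpSteps n A (by omega)]
  omega

/-- The shift loses only the element `2n-1`, and the cardinality recovers it. -/
theorem shiftUpSteps_inj {n : ℕ} {A B : Finset ℕ} (hA : A ⊆ Finset.Icc 2 (2 * n - 1))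
    (hB : B ⊆ Finset.Icc 2 (2 * n - 1)) (hcard : A.card = B.card)
    (h : shiftUpSteps n A = shiftUpSteps n B) : A = B := by
  have key (i : ℕ) (hi : i ≠ 2 * n - 1) : i ∈ A ↔ i ∈ B := by
    by_cases hi2 : i ∈ Finset.Icc 2 (2 * n - 1)
    · rw [Finset.mem_Icc] at hi2
      have := Finset.ext_iff.1 h (i + 1)
      simpa [shiftUpSteps, show i + 1 ≤ 2 * n - 1 by omega, show 1 ≤ i by omega,
        show i ≠ 1 by omega] using this
    · exact ⟨fun h => absurd (hA h) hi2, fun h => absurd (hB h) hi2⟩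
  have herase : A.erase (2 * n - 1) = B.erase (2 * n - 1) := by
    ext i
    simp only [Finset.mem_erase]
    exact and_congr_right fun hi => key i hi
  have h1 := congrArg Finset.card herase
  rw [Finset.card_erase_eq_ite, Finset.card_erase_eq_ite] at h1
  have hpos {D : Finset ℕ} {i : ℕ} (hi : i ∈ D) : 0 < D.card := Finset.card_pos.2 ⟨i, hi⟩
  ext i
  by_cases hi : i = 2 * n - 1
  · subst hi
    constructor
    · intro hiA
      by_contra hiB
      rw [if_pos hiA, if_neg hiB] at h1
      have := hpos hiA
      omega
    · intro hiB
      by_contra hiA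
      rw [if_neg hiA, if_pos hiB] at h1
      have := hpos hiB
      omega
  · exact key i hi

open Classical in
theorem tutteEval_one_one_le {n : ℕ} (hn : 1 ≤ n) :
    tutteEval (reducedCatalanMatroid n) 1 1 ≤
      ((Finset.Icc 2 (2 * n - 1)).powerset.filter fun C : Finset ℕ => HasManyUpSteps n C).card := by
  have h0 : tutteEval (reducedCatalanMatroid n) 1 1 =
      ((Finset.Icc 2 (2 * n - 1)).powerset.filter fun A : Finset ℕ =>
        (reducedCatalanMatroid n).eRank.toNat ≤
          ((reducedCatalanMatroid n).eRk (A : Set ℕ)).toNat ∧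
        A.card ≤ ((reducedCatalanMatroid n).eRk (A : Set ℕ)).toNat).card := by
    rw [tutteEval_eq hn, Finset.card_filter, Nat.cast_sum]
    refine Finset.sum_congr rfl fun A _ => ?_
    -- Since `0 ^ 0 = 1`, exactly the sets with both exponents zero contribute.
    rw [sub_self, zero_pow_eq, zero_pow_eq]
    simp only [Nat.sub_eq_zero_iff_le]
    split_ifs <;> simp_all
  rw [h0, Nat.cast_le]
  refine Finset.card_le_card_of_injOn (shiftUpSteps n) ?_ ?_
  · intro A hA
    rw [Finset.mem_coe, Finset.mem_filter, Finset.mem_powerset] at hA ⊢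
    exact ⟨Finset.filter_subset _ _,
      hasManyUpSteps_shiftUpSteps (isUpStepSet_insert_one hn hA.1 hA.2.1 hA.2.2).1⟩
  · intro A hA B hB h
    rw [Finset.mem_coe, Finset.mem_filter, Finset.mem_powerset] at hA hB
    have h1 := (isUpStepSet_insert_one hn hA.1 hA.2.1 hA.2.2).2
    have h2 := (isUpStepSet_insert_one hn hB.1 hB.2.1 hB.2.2).2
    exact shiftUpSteps_inj hA.1 hB.1 (by omega) h

theorem mainTheorem7 (n : ℕ) (hn : 2 ≤ n) :
    max (tutteEval (reducedCatalanMatroid n) 2 0) (tutteEval (reducedCatalanMatroid n) 0 2) ≥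
      tutteEval (reducedCatalanMatroid n) 1 1 :=
  le_max_of_le_right
    ((tutteEval_one_one_le (by omega)).trans_eq (tutteEval_zero_two (by omega)).symm)
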